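/- Let $f\colon\mathbb{R}^J\to\left]-\infty,+\infty\right]$ be a convex function of Legendre type, that is, $f$ is convex; $f$ is differentiable on $U:=\operatorname{int}\operatorname{dom} f$ and $\|\nabla f(u)\|\to+\infty$ whenever $u\in U$ approaches a boundary point of $\operatorname{dom} f$; and $f$ is strictly convex on every convex subset of $\operatorname{dom}\partial f$. Let $D(x,y)=f(x)-f(y)-\langle\nabla f(y),x-y\rangle$ if $y\in U$ and $D(x,y)=+\infty$ otherwise be the associated Bregman distance. Let $C\subseteq U$ be a compact set containing at least two points, and let $x\in\operatorname{dom} f$ be the (right) $D$-Chebyshev center of $C$, i.e., a minimizer over $\mathbb{R}^J$ of the right Bregman farthest-distance function $F_C\colon z\mapsto\sup_{c\in C}D(z,c)$. Then the set $\Phi_C(x)=\{c\in C : D(x,c)=F_C(x)\}$ of farthest points of $C$ from $x$ contains at least two points. -/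

import Mathlib

namespace Bregman

/-- The (essential) domain of an extended-real-valued function: the points with a real value. -/
def effDom {J : ℕ} (g : EuclideanSpace ℝ (Fin J) → EReal) : Set (EuclideanSpace ℝ (Fin J)) :=
  {x | g x ≠ ⊥ ∧ g x ≠ ⊤}

/-- The real-valued function that agrees with `g` on `effDom g`; it is only used there. -/
noncomputable def realPart {J : ℕ} (g : EuclideanSpace ℝ (Fin J) → EReal) :
    EuclideanSpace ℝ (Fin J) → ℝ :=
  fun x => (g x).toReal

/-- The gradient of `g`; it is only used at interior points of `effDom g`. -/
noncomputable def grad {J : ℕ} (g : EuclideanSpace ℝ (Fin J) → EReal) :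
    EuclideanSpace ℝ (Fin J) → EuclideanSpace ℝ (Fin J) :=
  gradient (realPart g)

/-- `xs` is a subgradient of `g` at the point `x` of the domain of `g`. -/
def IsSubgradient {J : ℕ} (g : EuclideanSpace ℝ (Fin J) → EReal)
    (x xs : EuclideanSpace ℝ (Fin J)) : Prop :=
  x ∈ effDom g ∧
    ∀ h : EuclideanSpace ℝ (Fin J), g x + ((inner ℝ h xs : ℝ) : EReal) ≤ g (x + h)

/-- The domain of the subdifferential of `g`. -/
def subdiffDom {J : ℕ} (g : EuclideanSpace ℝ (Fin J) → EReal) :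
    Set (EuclideanSpace ℝ (Fin J)) :=
  {x | ∃ xs, IsSubgradient g x xs}

/-- Convexity of a function with values in `]-∞, +∞]`: the value `-∞` is not taken, and the
function is convex on its (convex) domain. -/
def IsConvexFun {J : ℕ} (g : EuclideanSpace ℝ (Fin J) → EReal) : Prop :=
  (∀ x, g x ≠ ⊥) ∧ ConvexOn ℝ (effDom g) (realPart g)

/-- Essential smoothness: differentiable on the interior of the domain, with the norm of the
gradient tending to `+∞` at every boundary point of the domain. -/
def EssentiallySmooth {J : ℕ} (g : EuclideanSpace ℝ (Fin J) → EReal) : Prop :=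
  (∀ x ∈ interior (effDom g), DifferentiableAt ℝ (realPart g) x) ∧
    ∀ z ∈ frontier (effDom g),
      Filter.Tendsto (fun x => ‖grad g x‖) (nhdsWithin z (interior (effDom g))) Filter.atTop

/-- Essential strict convexity: strictly convex on every convex subset of the domain of the
subdifferential. -/
def EssentiallyStrictlyConvex {J : ℕ} (g : EuclideanSpace ℝ (Fin J) → EReal) : Prop :=
  ∀ S : Set (EuclideanSpace ℝ (Fin J)), S ⊆ subdiffDom g → Convex ℝ S →
    StrictConvexOn ℝ S (realPart g)

/-- Convex functions of Legendre type. -/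
structure IsLegendre {J : ℕ} (f : EuclideanSpace ℝ (Fin J) → EReal) : Prop where
  convex : IsConvexFun f
  smooth : EssentiallySmooth f
  strictConvex : EssentiallyStrictlyConvex f

open Classical in
/-- The Bregman distance `D(x, y) = f x - f y - ⟪∇f y, x - y⟫` if `y ∈ int dom f`, and `+∞`
otherwise. -/
noncomputable def dist {J : ℕ} (f : EuclideanSpace ℝ (Fin J) → EReal)
    (x y : EuclideanSpace ℝ (Fin J)) : EReal :=
  if y ∈ interior (effDom f) then f x - f y - ((inner ℝ (grad f y) (x - y) : ℝ) : EReal) else ⊤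

/-- The right Bregman farthest-distance function of `C`. -/
noncomputable def farthestDist {J : ℕ} (f : EuclideanSpace ℝ (Fin J) → EReal)
    (C : Set (EuclideanSpace ℝ (Fin J))) (x : EuclideanSpace ℝ (Fin J)) : EReal :=
  ⨆ c ∈ C, dist f x c

/-- The right Bregman farthest-point map of `C`; its value is empty at points outside the domain
of `f`. -/
def farthestPoints {J : ℕ} (f : EuclideanSpace ℝ (Fin J) → EReal)
    (C : Set (EuclideanSpace ℝ (Fin J))) (x : EuclideanSpace ℝ (Fin J)) :
    Set (EuclideanSpace ℝ (Fin J)) :=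
  {c | x ∈ effDom f ∧ c ∈ C ∧ dist f x c = farthestDist f C x}

/-- `x` is a Bregman-Chebyshev center of `C`: a point of the domain of `f` that minimizes the right
Bregman farthest-distance function over the whole space. (Neither uniqueness of the minimizer nor
its membership in the interior of the domain is built in.) -/
def IsChebyshevCenter {J : ℕ} (f : EuclideanSpace ℝ (Fin J) → EReal)
    (C : Set (EuclideanSpace ℝ (Fin J))) (x : EuclideanSpace ℝ (Fin J)) : Prop :=
  x ∈ effDom f ∧ ∀ y, farthestDist f C x ≤ farthestDist f C y

end Bregman

/-!
Write `φ` for the real part of `f`, `U` for the interior of its domain, and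
`D(x, c) = φ x - φ c - ⟪∇φ c, x - c⟫`. The gradient of a differentiable convex function is
continuous (`ConvexOn.continuousOn_gradient_interior`), so `D(x, ·)` is continuous on the compact
set `C` and attains its maximum `r = F_C(x)` at some `c₀ ∈ C`. Strict convexity on `U` makes
`D(x, c) > 0` for `c ≠ x` (`bregman_pos`), hence `r > 0` because `C` has two points.

If `c₀` were the only maximizer, then moving `x` a little towards `c₀` would lower the farthest
distance. Indeed `D(·, c)` is convex, so the point `z = (1 - t) x + t c₀` satisfies
`D(z, c) ≤ (1 - t) D(x, c) + t D(c₀, c)`. For `c` near `c₀` the second term gains, since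
`D(c₀, c)` is close to `D(c₀, c₀) = 0 < r`; away from `c₀` the first term has room, since `D(x, c)`
stays below `r` by compactness (`IsCompact.exists_convex_combination_lt`). This contradicts the
minimality of `x`. The point `x` may lie on the boundary of the domain: no derivative at `x` is
taken.
-/

open Filter Topology Set

namespace Bregman

section Convex

variable {E : Type*} [NormedAddCommGroup E] [InnerProductSpace ℝ E] [CompleteSpace E]
  {s : Set E} {φ : E → ℝ}

/-- The difference quotients of a function along a line, taken for positive increments, tend to the
directional derivative. -/
lemma _root_.DifferentiableAt.tendsto_slope_inner_gradient {c : E} (h : DifferentiableAt ℝ φ c)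
    (v : E) : Tendsto (fun t : ℝ => (φ (c + t • v) - φ c) / t) (𝓝[>] 0)
      (𝓝 (inner ℝ (gradient φ c) v)) := by
  have hl := (h.hasGradientAt.hasFDerivAt.hasLineDerivAt v).tendsto_slope_zero_right
  simpa [div_eq_inv_mul] using hl

/-- The gradient inequality for convex functions. -/
lemma _root_.ConvexOn.add_inner_gradient_le (hφ : ConvexOn ℝ s φ) {c z : E} (hc : c ∈ s)
    (hz : z ∈ s) (hd : DifferentiableAt ℝ φ c) :
    φ c + inner ℝ (gradient φ c) (z - c) ≤ φ z := by
  suffices inner ℝ (gradient φ c) (z - c) ≤ φ z - φ c by linarith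
  refine le_of_tendsto (hd.tendsto_slope_inner_gradient (z - c)) ?_
  filter_upwards [Ioo_mem_nhdsGT (zero_lt_one (α := ℝ))] with t ht
  have h := hφ.2 hc hz (sub_nonneg.2 ht.2.le) ht.1.le (by ring)
  have he : (1 - t) • c + t • z = c + t • (z - c) := by module
  rw [he, smul_eq_mul, smul_eq_mul] at h
  rw [div_le_iff₀ ht.1]
  linarith

/-- The directional derivative of a convex function is upper semicontinuous in the base point, being
an infimum of difference quotients. -/
lemma _root_.ConvexOn.eventually_inner_gradient_lt [FiniteDimensional ℝ E] (hφ : ConvexOn ℝ s φ)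
    (hd : ∀ y ∈ interior s, DifferentiableAt ℝ φ y) {c : E} (hc : c ∈ interior s) (v : E) {a : ℝ}
    (ha : inner ℝ (gradient φ c) v < a) :
    ∀ᶠ y in 𝓝 c, inner ℝ (gradient φ y) v < a := by
  have hcont : ∀ y ∈ interior s, ContinuousAt φ y := fun y hy => (hd y hy).continuousAt
  have hU : ∀ᶠ t : ℝ in 𝓝[>] 0, c + t • v ∈ interior s := by
    have h : Tendsto (fun t : ℝ => c + t • v) (𝓝 0) (𝓝 c) := by
      have : Continuous fun t : ℝ => c + t • v := by fun_prop
      simpa using this.tendsto 0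
    exact (h.eventually (isOpen_interior.mem_nhds hc)).filter_mono nhdsWithin_le_nhds
  obtain ⟨t, ⟨hta, htU⟩, ht⟩ := ((((hd c hc).tendsto_slope_inner_gradient v).eventually
    (gt_mem_nhds ha)).and hU |>.and self_mem_nhdsWithin).exists
  have ht : 0 < t := ht
  have hshift : Tendsto (fun y => y + t • v) (𝓝 c) (𝓝 (c + t • v)) :=
    tendsto_id.add_const _
  have hq : Tendsto (fun y => (φ (y + t • v) - φ y) / t) (𝓝 c)
      (𝓝 ((φ (c + t • v) - φ c) / t)) :=
    (((hcont _ htU).tendsto.comp hshift).sub (hcont c hc).tendsto).div_const t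
  filter_upwards [hq.eventually (gt_mem_nhds hta), isOpen_interior.mem_nhds hc,
    hshift.eventually (isOpen_interior.mem_nhds htU)] with y hya hyU hytU
  refine lt_of_le_of_lt ?_ hya
  have h := hφ.add_inner_gradient_le (interior_subset hyU) (interior_subset hytU) (hd y hyU)
  rw [add_sub_cancel_left, inner_smul_right] at h
  rw [le_div_iff₀ ht]
  linarith

/-- The gradient of a differentiable convex function on a finite-dimensional space is continuous. -/
lemma _root_.ConvexOn.continuousOn_gradient_interior [FiniteDimensional ℝ E] (hφ : ConvexOn ℝ s φ)
    (hd : ∀ y ∈ interior s, DifferentiableAt ℝ φ y) :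
    ContinuousOn (gradient φ) (interior s) := by
  intro c hc
  refine ContinuousAt.continuousWithinAt ?_
  have hv : ∀ v, ContinuousAt (fun y => inner ℝ (gradient φ y) v) c := by
    intro v
    refine tendsto_order.2 ⟨fun a ha => ?_, fun a ha =>
      hφ.eventually_inner_gradient_lt hd hc v ha⟩
    -- Differentiability makes the derivative odd in the direction, so the lower bound is the upper
    -- bound for `-v`.
    have h := hφ.eventually_inner_gradient_lt hd hc (-v) (a := -a) (by
      rw [inner_neg_right]; linarith)
    filter_upwards [h] with y hy
    rw [inner_neg_right] at hy
    linarith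
  have hsum : gradient φ = fun y => ∑ i, inner ℝ (gradient φ y) (stdOrthonormalBasis ℝ E i) •
      stdOrthonormalBasis ℝ E i := by
    funext y
    simp_rw [real_inner_comm _ (gradient φ y)]
    exact ((stdOrthonormalBasis ℝ E).sum_repr' _).symm
  rw [hsum]
  exact tendsto_finsetSum _ fun i _ => (hv _).tendsto.smul_const _

/-- The real-valued Bregman distance `φ x - φ c - ⟪∇φ c, x - c⟫`. -/
noncomputable def bregman (φ : E → ℝ) (x c : E) : ℝ :=
  φ x - φ c - inner ℝ (gradient φ c) (x - c)

lemma bregman_self (c : E) : bregman φ c c = 0 := by simp [bregman]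

lemma continuousOn_bregman [FiniteDimensional ℝ E] (hφ : ConvexOn ℝ s φ)
    (hd : ∀ y ∈ interior s, DifferentiableAt ℝ φ y) (x : E) :
    ContinuousOn (bregman φ x) (interior s) := by
  have h1 := hφ.continuousOn_gradient_interior hd
  have h2 := hφ.continuousOn_interior
  unfold bregman
  fun_prop

/-- The Bregman distance is convex in its first argument. -/
lemma bregman_convex_combination_le (hφ : ConvexOn ℝ s φ) {x y : E} (hx : x ∈ s) (hy : y ∈ s)
    (c : E) {t : ℝ} (h0 : 0 ≤ t) (h1 : t ≤ 1) :
    bregman φ ((1 - t) • x + t • y) c ≤ (1 - t) * bregman φ x c + t * bregman φ y c := by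
  have h := hφ.2 hx hy (sub_nonneg.2 h1) h0 (by ring)
  have he : (1 - t) • x + t • y - c = (1 - t) • (x - c) + t • (y - c) := by module
  simp only [bregman, he, inner_add_right, inner_smul_right]
  simp only [smul_eq_mul] at h
  linarith

/-- The Bregman distance is positive off the diagonal. The first argument may be a boundary point:
strict convexity is applied on the half of the segment that ends at `c`. -/
lemma bregman_pos (hφ : ConvexOn ℝ s φ) (hs : StrictConvexOn ℝ (interior s) φ) {x c : E}
    (hx : x ∈ s) (hc : c ∈ interior s) (hd : DifferentiableAt ℝ φ c) (hne : c ≠ x) :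
    0 < bregman φ x c := by
  have hm : (1 / 2 : ℝ) • c + (1 / 2 : ℝ) • x ∈ interior s :=
    hφ.1.combo_interior_self_mem_interior hc hx (by norm_num) (by norm_num) (by norm_num)
  set m := (1 / 2 : ℝ) • c + (1 / 2 : ℝ) • x with hmdef
  have hmc : c ≠ m := by
    intro h
    refine hne ?_
    have h2 : (2 : ℝ) • c = (2 : ℝ) • m := by rw [← h]
    have h3 : (2 : ℝ) • m = c + x := by rw [hmdef]; module
    rw [h3, two_smul] at h2
    exact add_left_cancel h2
  have hhalf : (0 : ℝ) < 1 / 2 := by norm_num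
  have hsc := hs.2 hc hm hmc hhalf hhalf (by norm_num)
  have hcm := hφ.2 (interior_subset hc) hx hhalf.le hhalf.le (by norm_num)
  have hq : (1 / 2 : ℝ) • c + (1 / 2 : ℝ) • m ∈ s :=
    hφ.1 (interior_subset hc) (interior_subset hm) hhalf.le hhalf.le (by norm_num)
  have hg := hφ.add_inner_gradient_le (interior_subset hc) hq hd
  have he : (1 / 2 : ℝ) • c + (1 / 2 : ℝ) • m - c = (1 / 4 : ℝ) • (x - c) := by
    rw [hmdef]; module
  rw [he, inner_smul_right] at hg
  simp only [smul_eq_mul, ← hmdef] at hsc hcm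
  unfold bregman
  linarith

end Convex

/-- If `u ≤ r` on a compact set with equality only where `w ≤ 0`, and `r > 0`, then some convex
combination of `u` and `w` is smaller than `r` on the whole set. -/
lemma _root_.IsCompact.exists_convex_combination_lt {X : Type*} [TopologicalSpace X]
    {C : Set X} (hC : IsCompact C) {u w : X → ℝ} (hu : ContinuousOn u C)
    (hw : ContinuousOn w C) {r : ℝ} (hr : 0 < r) (hur : ∀ c ∈ C, u c ≤ r)
    (heq : ∀ c ∈ C, u c = r → w c ≤ 0) :
    ∃ t : ℝ, 0 < t ∧ t < 1 ∧ ∀ c ∈ C, (1 - t) * u c + t * w c < r := by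
  -- On `A` the function `u` stays away from `r`; off `A` the function `w` is below `r / 2`.
  obtain ⟨A, hA, hAC⟩ : ∃ A, IsCompact A ∧ A = {c ∈ C | r / 2 ≤ w c} := by
    obtain ⟨F, hF, hFC⟩ := continuousOn_iff_isClosed.1 hw _ (isClosed_Ici (a := r / 2))
    refine ⟨F ∩ C, hC.inter_left hF, ?_⟩
    rw [← hFC]
    ext c
    simp [and_comm]
  have hsub : A ⊆ C := by rw [hAC]; exact sep_subset _ _
  have hoff : ∀ t : ℝ, 0 < t → t < 1 → ∀ c ∈ C, c ∉ A → (1 - t) * u c + t * w c < r := by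
    intro t h0 h1 c hc hcA
    have hwc : w c < r / 2 := by
      by_contra h
      exact hcA (by rw [hAC]; exact ⟨hc, not_lt.1 h⟩)
    have h2 := mul_le_mul_of_nonneg_left (hur c hc) (sub_nonneg.2 h1.le)
    have h3 := mul_lt_mul_of_pos_left hwc h0
    have h4 := mul_pos h0 hr
    linarith
  rcases A.eq_empty_or_nonempty with hemp | hne
  · exact ⟨1 / 2, by norm_num, by norm_num, fun c hc =>
      hoff _ (by norm_num) (by norm_num) c hc (by simp [hemp])⟩
  obtain ⟨a, haA, ha⟩ := hA.exists_isMaxOn hne (hu.mono hsub)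
  obtain ⟨b, hbA, hb⟩ := hA.exists_isMaxOn hne (hw.mono hsub)
  have hlt : u a < r := by
    refine lt_of_le_of_ne (hur a (hsub haA)) fun h => ?_
    have h1 := heq a (hsub haA) h
    rw [hAC] at haA
    have h2 := haA.2
    linarith
  have hlim : Tendsto (fun t : ℝ => (1 - t) * u a + t * w b) (𝓝[>] 0) (𝓝 (u a)) := by
    have hc : Continuous fun t : ℝ => (1 - t) * u a + t * w b := by fun_prop
    have := hc.tendsto 0
    simp only [sub_zero, one_mul, zero_mul, add_zero] at this
    exact this.mono_left nhdsWithin_le_nhds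
  obtain ⟨t, htr, ht⟩ := ((hlim.eventually (gt_mem_nhds hlt)).and
    (Ioo_mem_nhdsGT (zero_lt_one (α := ℝ)))).exists
  refine ⟨t, ht.1, ht.2, fun c hc => ?_⟩
  by_cases hcA : c ∈ A
  · have h1 := mul_le_mul_of_nonneg_left (ha hcA) (sub_nonneg.2 ht.2.le)
    have h2 := mul_le_mul_of_nonneg_left (hb hcA) ht.1.le
    linarith
  · exact hoff t ht.1 ht.2 c hc hcA

variable {J : ℕ} {f : EuclideanSpace ℝ (Fin J) → EReal}

lemma dist_eq_coe_bregman {x c : EuclideanSpace ℝ (Fin J)} (hx : x ∈ effDom f)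
    (hc : c ∈ interior (effDom f)) : dist f x c = (bregman (realPart f) x c : EReal) := by
  have hcd := interior_subset hc
  rw [dist, if_pos hc, ← EReal.coe_toReal hx.2 hx.1, ← EReal.coe_toReal hcd.2 hcd.1]
  rfl

/-- Where `f` is differentiable, its gradient is a subgradient, so the interior of the domain lies in
the domain of the subdifferential. -/
lemma interior_effDom_subset_subdiffDom (hconv : IsConvexFun f)
    (hd : ∀ y ∈ interior (effDom f), DifferentiableAt ℝ (realPart f) y) :
    interior (effDom f) ⊆ subdiffDom f := by
  intro c hc
  have hcd := interior_subset hc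
  refine ⟨gradient (realPart f) c, hcd, fun h => ?_⟩
  by_cases htop : f (c + h) = ⊤
  · rw [htop]; exact le_top
  have hh : c + h ∈ effDom f := ⟨hconv.1 _, htop⟩
  have hg := hconv.2.add_inner_gradient_le hcd hh (hd c hc)
  rw [add_sub_cancel_left, real_inner_comm] at hg
  rw [← EReal.coe_toReal hcd.2 hcd.1, ← EReal.coe_toReal hh.2 hh.1]
  exact_mod_cast hg

/-- If the maximum of `D(x, ·)` over `C` is attained at `c`, it is the farthest distance. -/
lemma farthestDist_eq_of_isMaxOn {C : Set (EuclideanSpace ℝ (Fin J))}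
    (hCU : C ⊆ interior (effDom f)) {x c : EuclideanSpace ℝ (Fin J)} (hx : x ∈ effDom f)
    (hc : c ∈ C) (hmax : IsMaxOn (bregman (realPart f) x) C c) :
    farthestDist f C x = (bregman (realPart f) x c : EReal) := by
  refine le_antisymm (iSup₂_le fun y hy => ?_) ?_
  · rw [dist_eq_coe_bregman hx (hCU hy)]
    exact EReal.coe_le_coe (hmax hy)
  · rw [← dist_eq_coe_bregman hx (hCU hc)]
    exact le_iSup₂ (f := fun c _ => dist f x c) c hc

end Bregman

open Bregman in
theorem corollaryc {J : ℕ} (f : EuclideanSpace ℝ (Fin J) → EReal)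
    (hf : Bregman.IsLegendre f)
    (C : Set (EuclideanSpace ℝ (Fin J)))
    (hCU : C ⊆ interior (Bregman.effDom f))
    (hC : IsCompact C) (hC2 : C.Nontrivial)
    (x : EuclideanSpace ℝ (Fin J)) (hx : Bregman.IsChebyshevCenter f C x) :
    (Bregman.farthestPoints f C x).Nontrivial := by
  obtain ⟨hxd, hmin⟩ := hx
  have hφ := hf.convex.2
  have hd := hf.smooth.1
  have hcont : ∀ z, ContinuousOn (bregman (realPart f) z) C := fun z =>
    (continuousOn_bregman hφ hd z).mono hCU
  have hstrict : StrictConvexOn ℝ (interior (effDom f)) (realPart f) :=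
    hf.strictConvex _ (interior_effDom_subset_subdiffDom hf.convex hd) hφ.1.interior
  obtain ⟨c₀, hc₀, hmax⟩ := hC.exists_isMaxOn hC2.nonempty (hcont x)
  have hF := farthestDist_eq_of_isMaxOn hCU hxd hc₀ hmax
  have hr : 0 < bregman (realPart f) x c₀ := by
    obtain ⟨c, hc, hcx⟩ := hC2.exists_ne x
    exact (bregman_pos hφ hstrict hxd (hCU hc) (hd c (hCU hc)) hcx).trans_le (hmax hc)
  have hmem : c₀ ∈ farthestPoints f C x :=
    ⟨hxd, hc₀, by rw [hF, dist_eq_coe_bregman hxd (hCU hc₀)]⟩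
  by_contra hnt
  rw [Set.not_nontrivial_iff] at hnt
  obtain ⟨t, ht0, ht1, hlt⟩ := hC.exists_convex_combination_lt (hcont x) (hcont c₀) hr
    (fun c hc => hmax hc) fun c hc h => by
      have hcm : c ∈ farthestPoints f C x :=
        ⟨hxd, hc, by rw [hF, dist_eq_coe_bregman hxd (hCU hc), h]⟩
      rw [hnt hcm hmem, bregman_self]
  have hc₀d := interior_subset (hCU hc₀)
  have hz : (1 - t) • x + t • c₀ ∈ effDom f :=
    hφ.1 hxd hc₀d (sub_nonneg.2 ht1.le) ht0.le (by ring)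
  obtain ⟨c₁, hc₁, hmax₁⟩ := hC.exists_isMaxOn hC2.nonempty (hcont ((1 - t) • x + t • c₀))
  have hle := hmin ((1 - t) • x + t • c₀)
  rw [hF, farthestDist_eq_of_isMaxOn hCU hz hc₁ hmax₁, EReal.coe_le_coe_iff] at hle
  exact absurd ((bregman_convex_combination_le hφ hxd hc₀d c₁ ht0.le ht1.le).trans_lt
    (hlt c₁ hc₁)) (not_lt.2 hle)
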